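/- Let $a\ge 0$ and let $r,q,p,r_0,q_0,p_0$ be real continuous functions on $[a,\infty)$ with $r,p,r_0,p_0>0$ and $$r\le r_0,\qquad p_0\le p,\qquad q_0\ge q\qquad\text{on }[a,\infty).$$ For the equation $$(r y'')''-(q y')'=p\,y \qquad (1)$$ on $[a,\infty)$ put $y_1=r y''$ and $Ty=(r y'')'-q y'$; a solution is a function $y$ for which $y,y',y_1,Ty$ are differentiable on $[a,\infty)$ and $(Ty)'=p\,y$. The systems-conjugate point $\hat\eta_1(a)$ (respectively the systems-focal point $\hat\mu_1(a)$) is the smallest $b\in(a,\infty)$ for which some nontrivial solution satisfies $y(a)=y_1(a)=y(b)=y_1(b)=0$ (respectively $y(a)=y_1(a)=y'(b)=Ty(b)=0$); it is said to exist if there is such a smallest $b$. Let $\hat\eta_1^0(a)$ and $\hat\mu_1^0(a)$ denote the corresponding points for the comparison equation $$(r_0y'')''-(q_0y')'=p_0\,y .\qquad (2)$$ 1. If $\hat\mu_1^0(a)$ exists for (2), then $\hat\mu_1(a)$ exists for (1), and $a<\hat\mu_1(a)\le\hat\mu_1^0(a)$. 2. If $\hat\eta_1^0(a)$ exists for (2),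 then $\hat\eta_1(a)$ exists for (1), and $a<\hat\eta_1(a)\le\hat\eta_1^0(a)$. -/

import Mathlib

open Set

namespace FourthOrder

/-- Derivative of `f` relative to the half-line `[a, ∞)` (one-sided at the end point `a`). -/
noncomputable def D (a : ℝ) (f : ℝ → ℝ) : ℝ → ℝ := fun x => derivWithin f (Ici a) x

/-- The quasi-derivative `y₁ = r y''`. -/
noncomputable def quasiD₁ (r : ℝ → ℝ) (a : ℝ) (y : ℝ → ℝ) : ℝ → ℝ :=
  fun x => r x * D a (D a y) x

/-- The quasi-derivative `T y = (r y'')' - q y'`. -/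
noncomputable def quasiT (r q : ℝ → ℝ) (a : ℝ) (y : ℝ → ℝ) : ℝ → ℝ :=
  fun x => D a (quasiD₁ r a y) x - q x * D a y x

/-- `y` solves `(r y'')'' - (q y')' = p y` on `[a, ∞)`. As the coefficients are only continuous,
the equation is read through quasi-derivatives: `y`, `y'`, `y₁ = r y''` and
`T y = (r y'')' - q y'` are differentiable on `[a, ∞)`, and `(T y)' = p y` there. -/
structure IsSolution (r q p : ℝ → ℝ) (a : ℝ) (y : ℝ → ℝ) : Prop where
  diff_y : DifferentiableOn ℝ y (Ici a)
  diff_y' : DifferentiableOn ℝ (D a y) (Ici a)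
  diff_y₁ : DifferentiableOn ℝ (quasiD₁ r a y) (Ici a)
  diff_T : DifferentiableOn ℝ (quasiT r q a y) (Ici a)
  eqn : ∀ x ∈ Ici a, D a (quasiT r q a y) x = p x * y x

/-- A solution on `[a, ∞)` which does not vanish identically there. -/
def IsNontrivialSolution (r q p : ℝ → ℝ) (a : ℝ) (y : ℝ → ℝ) : Prop :=
  IsSolution r q p a y ∧ ∃ x ∈ Ici a, y x ≠ 0

/-- `b` is the systems-conjugate point `η̂₁(a)`: the smallest `b ∈ (a, ∞)` for which
`y(a) = y₁(a) = y(b) = y₁(b) = 0` holds for some nontrivial solution `y`. -/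
def IsSystemsConjugatePoint (r q p : ℝ → ℝ) (a b : ℝ) : Prop :=
  IsLeast {c : ℝ | a < c ∧ ∃ y : ℝ → ℝ, IsNontrivialSolution r q p a y ∧
    y a = 0 ∧ quasiD₁ r a y a = 0 ∧ y c = 0 ∧ quasiD₁ r a y c = 0} b

/-- `b` is the systems-focal point `μ̂₁(a)`: the smallest `b ∈ (a, ∞)` for which
`y(a) = y₁(a) = y'(b) = T y(b) = 0` holds for some nontrivial solution `y`. -/
def IsSystemsFocalPoint (r q p : ℝ → ℝ) (a b : ℝ) : Prop :=
  IsLeast {c : ℝ | a < c ∧ ∃ y : ℝ → ℝ, IsNontrivialSolution r q p a y ∧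
    y a = 0 ∧ quasiD₁ r a y a = 0 ∧ D a y c = 0 ∧ quasiT r q a y c = 0} b

end FourthOrder

/-! The solutions of (1) with `y(a) = y₁(a) = 0` form a plane, spanned by two solutions `u`, `v`
(`IsConjoinedPair`). A nontrivial one meets the conjugate (focal) condition at `c` exactly when the
minor `ym` (`zT`) of the pair vanishes at `c`, so the claim is that this minor has a zero in `(a,
b]` whenever (2) has a nontrivial solution `y` satisfying the boundary conditions at `a` and `b`.

Suppose it has none. Then `yz`, the Wronskian of `u` and `v`, is positive on `(a, b]`: at once for
`ym`, since `yz' = ym / r`, and by a first-zero argument with the Plücker relation for `zT`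
(`pos_of_zT_ne_zero`). Hence at each `x` in `(a, b]` there is one `w` in the plane with `w = y` and
`w' = y'` at `x`, and its data give a quadratic form `Q = w' w₁ - w Tw` in `(y, y')`. Picone's
inequality says that `φ = y' y₁ - y Ty - Q` is nondecreasing and nonnegative (`picone`). The form is
singular at `a`; the sign of `φ` there comes from comparing energies on short intervals
(`form_le_near`).

At `b` the boundary conditions annihilate `y' y₁ - y Ty`, while `Q` becomes a positive multiple of
`y'²` (conjugate case) or `y²` (focal case). So `y(b) = y'(b) = 0`, which forces equality in
Picone's inequality and then `y = 0` (`eq_zero_of_picone_eq`), a contradiction. -/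

namespace FourthOrder

/-! ### Global existence by a weighted contraction. -/

section Existence

open intervalIntegral BoundedContinuousFunction

variable {E : Type*} [NormedAddCommGroup E] [NormedSpace ℝ E]

/-- The integrand is half the derivative of the exponential. This factor one half becomes the
contraction constant below. -/
lemma integral_mul_exp_integral {K : ℝ → ℝ} (hK : Continuous K) (a x : ℝ) :
    ∫ t in a..x, K t * Real.exp (∫ s in a..t, 2 * K s) =
      (Real.exp (∫ s in a..x, 2 * K s) - 1) / 2 := by
  have hK2 : Continuous fun s => 2 * K s := by fun_prop
  have hd : ∀ t, HasDerivAt (fun t => ∫ s in a..t, 2 * K s) (2 * K t) t := fun t =>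
    integral_hasDerivAt_right (hK2.intervalIntegrable _ _)
      (hK2.stronglyMeasurableAtFilter _ _) hK2.continuousAt
  have hc : Continuous fun t => ∫ s in a..t, 2 * K s :=
    continuous_iff_continuousAt.2 fun t => (hd t).continuousAt
  rw [integral_eq_sub_of_hasDerivAt (f := fun t => Real.exp (∫ s in a..t, 2 * K s) / 2)]
  · simp; ring
  · intro t _
    have := ((hd t).exp).div_const 2
    exact this.congr_deriv (by ring)
  · exact (hK.mul (Real.continuous_exp.comp hc)).intervalIntegrable _ _

/-- Global existence for `Y' = f(x, Y)` on `[a, ∞)` when `f(x, ·)` is Lipschitz with a constant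
that depends continuously on `x`. -/
theorem exists_solution_Ici [CompleteSpace E] (a : ℝ) {f : ℝ → E → E}
    (hf : Continuous (Function.uncurry f)) {K : ℝ → ℝ} (hK : Continuous K) (hK0 : ∀ t, 0 ≤ K t)
    (hLip : ∀ t x y, ‖f t x - f t y‖ ≤ K t * ‖x - y‖) (h0 : ∀ t, f t 0 = 0) (Y₀ : E) :
    ∃ Y : ℝ → E, Y a = Y₀ ∧ ∀ x ∈ Ici a, HasDerivWithinAt Y (f x (Y x)) (Ici a) x := by
  have hK2 : Continuous fun s => 2 * K s := by fun_prop
  -- Bielecki weight: the unknown is `Z = exp(-L) • Y`, sought among bounded continuous functions,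
  -- so that one fixed point covers the whole half-line.
  set L : ℝ → ℝ := fun t => ∫ s in a..t, 2 * K s with hL
  have hLc : Continuous L := continuous_iff_continuousAt.2 fun t =>
    (integral_hasDerivAt_right (hK2.intervalIntegrable a t)
      (hK2.stronglyMeasurableAtFilter _ _) hK2.continuousAt).continuousAt
  have hL0 : ∀ x, a ≤ x → 0 ≤ L x := fun x hx =>
    integral_nonneg hx fun t _ => by have := hK0 t; positivity
  have hcont : ∀ Z : ℝ →ᵇ E, Continuous fun t => f t (Real.exp (L t) • Z t) := fun Z => by
    have : Continuous fun t => (t, Real.exp (L t) • Z t) := by fun_prop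
    exact hf.comp this
  have key : ∀ (Z W : ℝ →ᵇ E) (x : ℝ), a ≤ x →
      ‖(∫ t in a..x, f t (Real.exp (L t) • Z t)) - ∫ t in a..x, f t (Real.exp (L t) • W t)‖ ≤
        (Real.exp (L x) - 1) / 2 * dist Z W := by
    intro Z W x hx
    rw [← integral_sub ((hcont Z).intervalIntegrable _ _) ((hcont W).intervalIntegrable _ _),
      ← integral_mul_exp_integral hK, ← integral_mul_const]
    refine norm_integral_le_of_norm_le hx (Filter.Eventually.of_forall fun t _ => ?_) ?_
    · refine (hLip t _ _).trans ?_
      rw [← smul_sub, norm_smul, Real.norm_of_nonneg (Real.exp_pos _).le, ← mul_assoc]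
      have := hK0 t
      gcongr
      rw [← dist_eq_norm]
      exact dist_coe_le_dist t
    · exact (((hK.mul (Real.continuous_exp.comp hLc)).mul continuous_const)).intervalIntegrable _ _
  have hint : ∀ Z : ℝ →ᵇ E, Continuous fun x => ∫ t in a..x, f t (Real.exp (L t) • Z t) :=
    fun Z => continuous_primitive (fun _ _ => (hcont Z).intervalIntegrable _ _) a
  -- Replacing `x` by `max a x` makes the Picard operator constant to the left of `a`, hence defined
  -- on all of `ℝ`.
  let G : (ℝ →ᵇ E) → ℝ → E := fun Z x =>
    Real.exp (-L (max a x)) • (Y₀ + ∫ t in a..(max a x), f t (Real.exp (L t) • Z t))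
  have hGc : ∀ Z, Continuous (G Z) := fun Z => by
    have h1 : Continuous fun x => ∫ t in a..(max a x), f t (Real.exp (L t) • Z t) :=
      (hint Z).comp (continuous_const.max continuous_id)
    have h2 : Continuous fun x => L (max a x) := hLc.comp (continuous_const.max continuous_id)
    exact (Real.continuous_exp.comp h2.neg).smul (continuous_const.add h1)
  have hexp : ∀ x, a ≤ x → Real.exp (-L x) * ((Real.exp (L x) - 1) / 2) ≤ 1 / 2 := by
    intro x hx
    have h1 : Real.exp (-L x) * Real.exp (L x) = 1 := by rw [← Real.exp_add]; simp
    nlinarith [Real.exp_pos (-L x)]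
  have hGb : ∀ Z x, ‖G Z x‖ ≤ ‖Y₀‖ + 1 / 2 * dist Z 0 := by
    intro Z x
    have hx : a ≤ max a x := le_max_left _ _
    have h1 := key Z 0 _ hx
    simp only [BoundedContinuousFunction.coe_zero, Pi.zero_apply, smul_zero, h0, integral_zero,
      sub_zero] at h1
    have h2 := hexp _ hx
    have h3 : Real.exp (-L (max a x)) ≤ 1 := by simpa using hL0 _ hx
    simp only [G, norm_smul, Real.norm_of_nonneg (Real.exp_pos _).le]
    calc _ ≤ Real.exp (-L (max a x)) * (‖Y₀‖ + (Real.exp (L (max a x)) - 1) / 2 * dist Z 0) := by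
          gcongr; exact (norm_add_le _ _).trans (by gcongr)
      _ = Real.exp (-L (max a x)) * ‖Y₀‖ +
          Real.exp (-L (max a x)) * ((Real.exp (L (max a x)) - 1) / 2) * dist Z 0 := by ring
      _ ≤ 1 * ‖Y₀‖ + 1 / 2 * dist Z 0 := by gcongr
      _ = _ := by ring
  let Φ : (ℝ →ᵇ E) → (ℝ →ᵇ E) := fun Z =>
    BoundedContinuousFunction.ofNormedAddCommGroup (G Z) (hGc Z) _ (hGb Z)
  have hΦ : ContractingWith (1 / 2) Φ := by
    refine ⟨by rw [div_lt_one] <;> norm_num, LipschitzWith.of_dist_le_mul fun Z W => ?_⟩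
    rw [BoundedContinuousFunction.dist_le (by positivity)]
    intro x
    have hx : a ≤ max a x := le_max_left _ _
    change dist (G Z x) (G W x) ≤ _
    simp only [G, dist_eq_norm, ← smul_sub, norm_smul, Real.norm_of_nonneg (Real.exp_pos _).le,
      add_sub_add_left_eq_sub]
    calc _ ≤ Real.exp (-L (max a x)) * ((Real.exp (L (max a x)) - 1) / 2 * dist Z W) := by
          gcongr; exact key Z W _ hx
      _ = Real.exp (-L (max a x)) * ((Real.exp (L (max a x)) - 1) / 2) * dist Z W := by ring
      _ ≤ 1 / 2 * dist Z W := by gcongr; exact hexp _ hx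
      _ = _ := by simp [dist_eq_norm]
  obtain ⟨Z, hZ⟩ : ∃ Z, Φ Z = Z := ⟨_, hΦ.fixedPoint_isFixedPt⟩
  have hZx : ∀ x ∈ Ici a, Real.exp (L x) • Z x =
      Y₀ + ∫ t in a..x, f t (Real.exp (L t) • Z t) := by
    intro x hx
    have h1 : Z x = G Z x := by exact congrArg (fun W : ℝ →ᵇ E => W x) hZ.symm
    have h2 : Real.exp (L x) * Real.exp (-L x) = 1 := by rw [← Real.exp_add]; simp
    rw [h1]
    simp only [G, max_eq_right (show a ≤ x from hx), smul_smul, h2, one_smul]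
  refine ⟨fun x => Real.exp (L x) • Z x, by simpa using hZx a self_mem_Ici, fun x hx => ?_⟩
  have hd : HasDerivAt (fun x => Y₀ + ∫ t in a..x, f t (Real.exp (L t) • Z t))
      (f x (Real.exp (L x) • Z x)) x :=
    (integral_hasDerivAt_right ((hcont Z).intervalIntegrable a x)
      ((hcont Z).stronglyMeasurableAtFilter _ _) (hcont Z).continuousAt).const_add _
  exact hd.hasDerivWithinAt.congr hZx (hZx x hx)

end Existence

/-! ### The equivalent first order system, with existence and uniqueness. -/

/-- The first order system `y' = z`, `z' = m / r`, `m' = T + q z`, `T' = p y` on `[a, ∞)`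
equivalent to `(r y'')'' - (q y')' = p y`. -/
structure IsQuasiSolution (r q p : ℝ → ℝ) (a : ℝ) (y z m T : ℝ → ℝ) : Prop where
  dy : ∀ x ∈ Ici a, HasDerivWithinAt y (z x) (Ici a) x
  dz : ∀ x ∈ Ici a, HasDerivWithinAt z (m x / r x) (Ici a) x
  dm : ∀ x ∈ Ici a, HasDerivWithinAt m (T x + q x * z x) (Ici a) x
  dT : ∀ x ∈ Ici a, HasDerivWithinAt T (p x * y x) (Ici a) x

variable {r q p : ℝ → ℝ} {a : ℝ}

lemma IsSolution.isQuasiSolution {y : ℝ → ℝ} (h : IsSolution r q p a y)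
    (hr : ∀ x ∈ Ici a, 0 < r x) :
    IsQuasiSolution r q p a y (D a y) (quasiD₁ r a y) (quasiT r q a y) where
  dy x hx := (h.diff_y x hx).hasDerivWithinAt
  dz x hx := (h.diff_y' x hx).hasDerivWithinAt.congr_deriv
    (by simp only [quasiD₁]; rw [mul_div_cancel_left₀ _ (hr x hx).ne']; rfl)
  dm x hx := (h.diff_y₁ x hx).hasDerivWithinAt.congr_deriv (by simp only [quasiT, D]; ring)
  dT x hx := (h.diff_T x hx).hasDerivWithinAt.congr_deriv (h.eqn x hx)

namespace IsQuasiSolution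

variable {y z m T y' z' m' T' : ℝ → ℝ}

lemma D_eq (h : IsQuasiSolution r q p a y z m T) {x : ℝ} (hx : x ∈ Ici a) : D a y x = z x :=
  (h.dy x hx).derivWithin (uniqueDiffOn_Ici a x hx)

lemma quasiD₁_eq (h : IsQuasiSolution r q p a y z m T) (hr : ∀ x ∈ Ici a, 0 < r x) {x : ℝ}
    (hx : x ∈ Ici a) : quasiD₁ r a y x = m x := by
  have h1 : D a (D a y) x = m x / r x :=
    ((h.dz x hx).congr (fun t ht => h.D_eq ht) (h.D_eq hx)).derivWithin (uniqueDiffOn_Ici a x hx)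
  rw [quasiD₁, h1, mul_div_cancel₀ _ (hr x hx).ne']

lemma quasiT_eq (h : IsQuasiSolution r q p a y z m T) (hr : ∀ x ∈ Ici a, 0 < r x) {x : ℝ}
    (hx : x ∈ Ici a) : quasiT r q a y x = T x := by
  have h1 : D a (quasiD₁ r a y) x = T x + q x * z x :=
    ((h.dm x hx).congr (fun t ht => h.quasiD₁_eq hr ht) (h.quasiD₁_eq hr hx)).derivWithin
      (uniqueDiffOn_Ici a x hx)
  rw [quasiT, h1, h.D_eq hx]; ring

lemma isSolution (h : IsQuasiSolution r q p a y z m T) (hr : ∀ x ∈ Ici a, 0 < r x) :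
    IsSolution r q p a y where
  diff_y x hx := (h.dy x hx).differentiableWithinAt
  diff_y' x hx := ((h.dz x hx).congr (fun _ ht => h.D_eq ht) (h.D_eq hx)).differentiableWithinAt
  diff_y₁ x hx := ((h.dm x hx).congr (fun _ ht => h.quasiD₁_eq hr ht)
    (h.quasiD₁_eq hr hx)).differentiableWithinAt
  diff_T x hx := ((h.dT x hx).congr (fun _ ht => h.quasiT_eq hr ht)
    (h.quasiT_eq hr hx)).differentiableWithinAt
  eqn x hx := ((h.dT x hx).congr (fun _ ht => h.quasiT_eq hr ht)
    (h.quasiT_eq hr hx)).derivWithin (uniqueDiffOn_Ici a x hx)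

lemma comb (h : IsQuasiSolution r q p a y z m T) (h' : IsQuasiSolution r q p a y' z' m' T')
    (α β : ℝ) :
    IsQuasiSolution r q p a (fun x => α * y x + β * y' x) (fun x => α * z x + β * z' x)
      (fun x => α * m x + β * m' x) (fun x => α * T x + β * T' x) where
  dy x hx := ((h.dy x hx).const_mul α).add ((h'.dy x hx).const_mul β)
  dz x hx := (((h.dz x hx).const_mul α).add ((h'.dz x hx).const_mul β)).congr_deriv (by ring)
  dm x hx := (((h.dm x hx).const_mul α).add ((h'.dm x hx).const_mul β)).congr_deriv (by ring)
  dT x hx := (((h.dT x hx).const_mul α).add ((h'.dT x hx).const_mul β)).congr_deriv (by ring)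

lemma eq_zero (h : IsQuasiSolution r q p a y z m T)
    (hrc : ContinuousOn r (Ici a)) (hqc : ContinuousOn q (Ici a)) (hpc : ContinuousOn p (Ici a))
    (hr : ∀ x ∈ Ici a, 0 < r x)
    (hy : y a = 0) (hz : z a = 0) (hm : m a = 0) (hT : T a = 0) {x : ℝ} (hx : x ∈ Ici a) :
    y x = 0 ∧ z x = 0 ∧ m x = 0 ∧ T x = 0 := by
  have hsub : Icc a x ⊆ Ici a := Icc_subset_Ici_self
  have hK : ContinuousOn (fun t => 1 + |(r t)⁻¹| + |q t| + |p t|) (Icc a x) :=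
    (((continuousOn_const.add (hrc.inv₀ fun t ht => (hr t ht).ne').abs).add hqc.abs).add
      hpc.abs).mono hsub
  obtain ⟨K, hKb⟩ := isCompact_Icc.bddAbove_image hK
  have hKb : ∀ t ∈ Icc a x, 1 + |(r t)⁻¹| + |q t| + |p t| ≤ K := fun t ht =>
    hKb (mem_image_of_mem _ ht)
  have hd : ∀ t ∈ Ici a, HasDerivWithinAt (fun t => (y t, z t, m t, T t))
      (z t, m t / r t, T t + q t * z t, p t * y t) (Ici a) t := fun t ht =>
    (h.dy t ht).prodMk ((h.dz t ht).prodMk ((h.dm t ht).prodMk (h.dT t ht)))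
  -- Grönwall on `[a, x]`, with `K` a bound of the coefficients on this compact interval.
  have key := eq_zero_of_abs_deriv_le_mul_abs_self_of_eq_zero_right (K := K) (a := a) (b := x)
    (fun t ht => ((hd t (hsub ht)).mono hsub).continuousWithinAt)
    (fun t ht => (hd t ht.1).mono (Ici_subset_Ici.2 ht.1)) (by simp [hy, hz, hm, hT]) ?_ x
    ⟨hx, le_rfl⟩
  · simpa using key
  · intro t ht
    have hb := hKb t ⟨ht.1, ht.2.le⟩
    set N := ‖(y t, z t, m t, T t)‖ with hN
    have hN0 : 0 ≤ N := norm_nonneg _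
    have h1 : |y t| ≤ N := norm_fst_le (y t, z t, m t, T t)
    have h2' : ‖(z t, m t, T t)‖ ≤ N := norm_snd_le (y t, z t, m t, T t)
    have h2 : |z t| ≤ N := (norm_fst_le (z t, m t, T t)).trans h2'
    have h3' : ‖(m t, T t)‖ ≤ N := (norm_snd_le (z t, m t, T t)).trans h2'
    have h3 : |m t| ≤ N := (norm_fst_le (m t, T t)).trans h3'
    have h4 : |T t| ≤ N := (norm_snd_le (m t, T t)).trans h3'
    have a1 := abs_nonneg (r t)⁻¹
    have a2 := abs_nonneg (q t)
    have a3 := abs_nonneg (p t)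
    refine norm_prod_le_iff.2 ⟨?_, norm_prod_le_iff.2 ⟨?_, norm_prod_le_iff.2 ⟨?_, ?_⟩⟩⟩ <;>
      simp only [Real.norm_eq_abs]
    · nlinarith
    · rw [div_eq_inv_mul, abs_mul]
      nlinarith [mul_le_mul_of_nonneg_left h3 a1]
    · refine (abs_add_le _ _).trans ?_
      rw [abs_mul]
      nlinarith [mul_le_mul_of_nonneg_left h2 a2]
    · rw [abs_mul]
      nlinarith [mul_le_mul_of_nonneg_left h1 a3]

end IsQuasiSolution

theorem exists_isQuasiSolution
    (hrc : ContinuousOn r (Ici a)) (hqc : ContinuousOn q (Ici a)) (hpc : ContinuousOn p (Ici a))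
    (hr : ∀ x ∈ Ici a, 0 < r x) (y₀ z₀ m₀ T₀ : ℝ) :
    ∃ y z m T : ℝ → ℝ, IsQuasiSolution r q p a y z m T ∧
      y a = y₀ ∧ z a = z₀ ∧ m a = m₀ ∧ T a = T₀ := by
  -- The coefficients are extended to the left of `a` by their values at `a`.
  have hmax : ∀ {g : ℝ → ℝ}, ContinuousOn g (Ici a) → Continuous fun x => g (max a x) := fun hg =>
    hg.comp_continuous (continuous_const.max continuous_id) fun x => le_max_left a x
  have hq' := hmax hqc
  have hp' := hmax hpc
  have hr' : Continuous fun x => (r (max a x))⁻¹ :=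
    (hmax hrc).inv₀ fun x => (hr _ (le_max_left a x)).ne'
  let f : ℝ → ℝ × ℝ × ℝ × ℝ → ℝ × ℝ × ℝ × ℝ := fun t Y =>
    (Y.2.1, (r (max a t))⁻¹ * Y.2.2.1, Y.2.2.2 + q (max a t) * Y.2.1, p (max a t) * Y.1)
  have hf : Continuous (Function.uncurry f) := by
    have e1 := hr'.comp (continuous_fst : Continuous (Prod.fst : ℝ × (ℝ × ℝ × ℝ × ℝ) → ℝ))
    have e2 := hq'.comp (continuous_fst : Continuous (Prod.fst : ℝ × (ℝ × ℝ × ℝ × ℝ) → ℝ))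
    have e3 := hp'.comp (continuous_fst : Continuous (Prod.fst : ℝ × (ℝ × ℝ × ℝ × ℝ) → ℝ))
    simp only [Function.comp_def] at e1 e2 e3
    change Continuous fun w : ℝ × (ℝ × ℝ × ℝ × ℝ) => (w.2.2.1, (r (max a w.1))⁻¹ * w.2.2.2.1,
      w.2.2.2.2 + q (max a w.1) * w.2.2.1, p (max a w.1) * w.2.1)
    exact Continuous.prodMk (by fun_prop) (Continuous.prodMk (e1.mul (by fun_prop))
      (Continuous.prodMk (Continuous.add (by fun_prop) (e2.mul (by fun_prop)))
        (e3.mul (by fun_prop))))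
  have hLip : ∀ t X W, ‖f t X - f t W‖ ≤
      (1 + |(r (max a t))⁻¹| + |q (max a t)| + |p (max a t)|) * ‖X - W‖ := by
    intro t X W
    set N := ‖X - W‖ with hN
    have hN0 : 0 ≤ N := norm_nonneg _
    have h1 : |X.1 - W.1| ≤ N := norm_fst_le (X - W)
    have h2' : ‖(X - W).2‖ ≤ N := norm_snd_le (X - W)
    have h2 : |X.2.1 - W.2.1| ≤ N := (norm_fst_le (X - W).2).trans h2'
    have h3' : ‖(X - W).2.2‖ ≤ N := (norm_snd_le (X - W).2).trans h2'
    have h3 : |X.2.2.1 - W.2.2.1| ≤ N := (norm_fst_le (X - W).2.2).trans h3'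
    have h4 : |X.2.2.2 - W.2.2.2| ≤ N := (norm_snd_le (X - W).2.2).trans h3'
    have a1 := abs_nonneg (r (max a t))⁻¹
    have a2 := abs_nonneg (q (max a t))
    have a3 := abs_nonneg (p (max a t))
    refine norm_prod_le_iff.2 ⟨?_, norm_prod_le_iff.2 ⟨?_, norm_prod_le_iff.2 ⟨?_, ?_⟩⟩⟩ <;>
      simp only [f, Real.norm_eq_abs, Prod.fst_sub, Prod.snd_sub]
    · nlinarith
    · rw [← mul_sub, abs_mul]
      nlinarith [mul_le_mul_of_nonneg_left h3 a1]
    · rw [add_sub_add_comm, ← mul_sub]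
      refine (abs_add_le _ _).trans ?_
      rw [abs_mul]
      nlinarith [mul_le_mul_of_nonneg_left h2 a2]
    · rw [← mul_sub, abs_mul]
      nlinarith [mul_le_mul_of_nonneg_left h1 a3]
  obtain ⟨Y, hY0, hY⟩ := exists_solution_Ici a hf
    (K := fun t => 1 + |(r (max a t))⁻¹| + |q (max a t)| + |p (max a t)|)
    (((continuous_const.add hr'.abs).add hq'.abs).add hp'.abs)
    (fun t => by positivity) hLip (fun t => by simp [f]) (y₀, z₀, m₀, T₀)
  refine ⟨fun x => (Y x).1, fun x => (Y x).2.1, fun x => (Y x).2.2.1, fun x => (Y x).2.2.2,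
    ⟨fun x hx => ?_, fun x hx => ?_, fun x hx => ?_, fun x hx => ?_⟩,
    by simp [hY0], by simp [hY0], by simp [hY0], by simp [hY0]⟩
  all_goals
    have e := (hY x hx).hasFDerivWithinAt
    have hm : max a x = x := max_eq_right hx
  · exact e.fst.hasDerivWithinAt.congr_deriv (by simp [f])
  · exact e.snd.fst.hasDerivWithinAt.congr_deriv (by simp [f, hm, div_eq_inv_mul])
  · exact e.snd.snd.fst.hasDerivWithinAt.congr_deriv (by simp [f, hm])
  · exact e.snd.snd.snd.hasDerivWithinAt.congr_deriv (by simp [f, hm])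

/-! ### Monotonicity tools and signs of the minors. -/

open Filter Topology

lemma lt_of_hasDerivWithinAt_pos {a s t : ℝ} {f f' : ℝ → ℝ} (has : a ≤ s) (hst : s < t)
    (hf : ∀ x ∈ Icc s t, HasDerivWithinAt f (f' x) (Ici a) x) (hf' : ∀ x ∈ Ioo s t, 0 < f' x) :
    f s < f t := by
  have hsub : Icc s t ⊆ Ici a := fun x hx => has.trans hx.1
  refine strictMonoOn_of_hasDerivWithinAt_pos (convex_Icc s t) (f := f) (f' := f')
    (fun x hx => ((hf x hx).mono hsub).continuousWithinAt) (fun x hx => ?_) (fun x hx => ?_)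
    (left_mem_Icc.2 hst.le) (right_mem_Icc.2 hst.le) hst
  · exact (hf x (interior_subset hx)).mono (interior_subset.trans hsub)
  · rw [interior_Icc] at hx; exact hf' x hx

lemma le_of_hasDerivWithinAt_nonneg {a s t : ℝ} {f f' : ℝ → ℝ} (has : a ≤ s) (hst : s ≤ t)
    (hf : ∀ x ∈ Icc s t, HasDerivWithinAt f (f' x) (Ici a) x) (hf' : ∀ x ∈ Ioo s t, 0 ≤ f' x) :
    f s ≤ f t := by
  have hsub : Icc s t ⊆ Ici a := fun x hx => has.trans hx.1
  refine monotoneOn_of_hasDerivWithinAt_nonneg (convex_Icc s t) (f := f) (f' := f')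
    (fun x hx => ((hf x hx).mono hsub).continuousWithinAt) (fun x hx => ?_) (fun x hx => ?_)
    (left_mem_Icc.2 hst) (right_mem_Icc.2 hst) hst
  · exact (hf x (interior_subset hx)).mono (interior_subset.trans hsub)
  · rw [interior_Icc] at hx; exact hf' x hx

lemma pos_of_ne_zero_of_pos_left {s t : ℝ} {f : ℝ → ℝ} (hst : s ≤ t) (hf : ContinuousOn f (Icc s t))
    (hs : 0 < f s) (hne : ∀ x ∈ Icc s t, f x ≠ 0) : 0 < f t := by
  by_contra! ht
  obtain ⟨x, hx, h0⟩ := intermediate_value_Icc' hst hf ⟨ht, hs.le⟩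
  exact hne x hx h0

/-- The `2 × 2` minors of a conjoined pair of solutions `u, v`, with respect to the coordinates
`(y, z)`, `(y, m)`, `(y, T)`, `(z, T)` and `(m, T)`: their differential equations, the Plücker
relation, and their values at `a` for the pair which starts with `z` and with `T`. -/
structure IsMinorSystem (r q p : ℝ → ℝ) (a : ℝ) (yz ym yT zT mT : ℝ → ℝ) : Prop where
  d_yz : ∀ x ∈ Ici a, HasDerivWithinAt yz (ym x / r x) (Ici a) x
  d_ym : ∀ x ∈ Ici a, HasDerivWithinAt ym (2 * yT x + q x * yz x) (Ici a) x
  d_yT : ∀ x ∈ Ici a, HasDerivWithinAt yT (zT x) (Ici a) x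
  d_zT : ∀ x ∈ Ici a, HasDerivWithinAt zT (mT x / r x - p x * yz x) (Ici a) x
  plucker : ∀ x ∈ Ici a, ym x * zT x = yz x * mT x + yT x ^ 2
  yz_left : yz a = 0
  ym_left : ym a = 0
  yT_left : yT a = 0
  zT_left : zT a = 1

namespace IsMinorSystem

variable {r q p : ℝ → ℝ} {a : ℝ} {yz ym yT zT mT : ℝ → ℝ}

lemma cont_ym (h : IsMinorSystem r q p a yz ym yT zT mT) : ContinuousOn ym (Ici a) :=
  fun x hx => (h.d_ym x hx).continuousWithinAt

lemma cont_yz (h : IsMinorSystem r q p a yz ym yT zT mT) : ContinuousOn yz (Ici a) :=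
  fun x hx => (h.d_yz x hx).continuousWithinAt

lemma cont_zT (h : IsMinorSystem r q p a yz ym yT zT mT) : ContinuousOn zT (Ici a) :=
  fun x hx => (h.d_zT x hx).continuousWithinAt

/-- Near such a `c`, `yT` is asymptotic to `zT c * (x - c)` and `yz` is `o(x - c)`, so the
derivative of `ym` has the sign of `x - c`. Used at `c = a` and at a putative first zero of `yz`. -/
lemma exists_sign_deriv_ym (h : IsMinorSystem r q p a yz ym yT zT mT) (hqc : ContinuousOn q (Ici a))
    {c : ℝ} (hc : c ∈ Ici a) (h1 : yz c = 0) (h2 : ym c = 0) (h3 : yT c = 0) (h4 : 0 < zT c) :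
    ∃ δ > 0, ∀ x ∈ Ici a, x ≠ c → |x - c| < δ → 0 < (x - c) * (2 * yT x + q x * yz x) := by
  have t1 := hasDerivWithinAt_iff_tendsto_slope.1 (h.d_yT c hc)
  have t2 := hasDerivWithinAt_iff_tendsto_slope.1 (h.d_yz c hc)
  have t3 : Tendsto q (𝓝[Ici a \ {c}] c) (𝓝 (q c)) :=
    (hqc c hc).mono_left (nhdsWithin_mono _ sdiff_subset)
  have t4 := (t1.const_mul 2).add (t3.mul t2)
  have hlim : 0 < 2 * zT c + q c * (ym c / r c) := by rw [h2]; simpa using h4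
  have hev := t4.eventually (lt_mem_nhds hlim)
  rw [eventually_nhdsWithin_iff, Metric.eventually_nhds_iff] at hev
  obtain ⟨δ, hδ, hev⟩ := hev
  refine ⟨δ, hδ, fun x hx hxc hd => ?_⟩
  have hpos := hev (show dist x c < δ from hd) ⟨hx, hxc⟩
  have hne : x - c ≠ 0 := sub_ne_zero.2 hxc
  simp only [slope_def_field, h1, h3, sub_zero] at hpos
  have : (x - c) * (2 * yT x + q x * yz x) =
      (x - c) ^ 2 * (2 * (yT x / (x - c)) + q x * (yz x / (x - c))) := by
    field_simp
  rw [this]; positivity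

lemma exists_pos_near (h : IsMinorSystem r q p a yz ym yT zT mT) (hqc : ContinuousOn q (Ici a))
    (hr : ∀ x ∈ Ici a, 0 < r x) :
    ∃ δ > 0, ∀ x ∈ Ioo a (a + δ), 0 < ym x ∧ 0 < yz x ∧ 0 < zT x := by
  obtain ⟨δ₁, hδ₁, h1⟩ := h.exists_sign_deriv_ym hqc self_mem_Ici h.yz_left h.ym_left h.yT_left
    (by rw [h.zT_left]; exact one_pos)
  have hev := (h.cont_zT a self_mem_Ici).eventually (lt_mem_nhds (show (0 : ℝ) < zT a by
    rw [h.zT_left]; exact one_pos))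
  rw [eventually_nhdsWithin_iff, Metric.eventually_nhds_iff] at hev
  obtain ⟨δ₂, hδ₂, h2⟩ := hev
  have hym : ∀ x ∈ Ioo a (a + min δ₁ δ₂), 0 < ym x := by
    intro x hx
    rw [← h.ym_left]
    refine lt_of_hasDerivWithinAt_pos le_rfl hx.1 (fun t ht => h.d_ym t ht.1) fun t ht => ?_
    have h0 : 0 < t - a := sub_pos.2 ht.1
    refine pos_of_mul_pos_right (h1 t ht.1.le ht.1.ne' ?_) h0.le
    rw [abs_of_pos h0]
    linarith [hx.2, ht.2, min_le_left δ₁ δ₂]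
  refine ⟨min δ₁ δ₂, lt_min hδ₁ hδ₂, fun x hx => ⟨hym x hx, ?_, ?_⟩⟩
  · rw [← h.yz_left]
    exact lt_of_hasDerivWithinAt_pos le_rfl hx.1 (fun t ht => h.d_yz t ht.1) fun t ht =>
      div_pos (hym t ⟨ht.1, ht.2.trans hx.2⟩) (hr t ht.1.le)
  · refine h2 ?_ hx.1.le
    rw [Real.dist_eq, abs_of_pos (sub_pos.2 hx.1)]
    linarith [hx.2, min_le_right δ₁ δ₂]

lemma pos_of_ym_ne_zero (h : IsMinorSystem r q p a yz ym yT zT mT) (hqc : ContinuousOn q (Ici a))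
    (hr : ∀ x ∈ Ici a, 0 < r x) {b : ℝ} (hne : ∀ x ∈ Ioc a b, ym x ≠ 0) :
    ∀ x ∈ Ioc a b, 0 < ym x ∧ 0 < yz x := by
  obtain ⟨δ, hδ, hpos⟩ := h.exists_pos_near hqc hr
  have hym : ∀ x ∈ Ioc a b, 0 < ym x := by
    intro x hx
    obtain ⟨s, hs1, hs2⟩ := exists_between (lt_min hx.1 (lt_add_of_pos_right a hδ))
    refine pos_of_ne_zero_of_pos_left (s := s) (hs2.le.trans (min_le_left _ _))
      (h.cont_ym.mono fun t ht => hs1.le.trans ht.1)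
      (hpos s ⟨hs1, hs2.trans_le (min_le_right _ _)⟩).1
      fun t ht => hne t ⟨hs1.trans_le ht.1, ht.2.trans hx.2⟩
  refine fun x hx => ⟨hym x hx, ?_⟩
  rw [← h.yz_left]
  exact lt_of_hasDerivWithinAt_pos le_rfl hx.1 (fun t ht => h.d_yz t ht.1) fun t ht =>
    div_pos (hym t ⟨ht.1, ht.2.le.trans hx.2⟩) (hr t ht.1.le)

/-- At a first zero `c` of `yz` the Plücker relation gives `ym * zT = yT ^ 2`, so `ym c ≥ 0`. If `ym
c > 0`, then `yz` increases up to `c`. If `ym c = 0`, then `yT c = 0` too, and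
`exists_sign_deriv_ym` makes `ym` positive just left of `c`, so `yz` increases again. Both
contradict `yz` falling from positive values to zero. -/
lemma pos_of_zT_ne_zero (h : IsMinorSystem r q p a yz ym yT zT mT) (hqc : ContinuousOn q (Ici a))
    (hr : ∀ x ∈ Ici a, 0 < r x) {b : ℝ} (hne : ∀ x ∈ Ioc a b, zT x ≠ 0) :
    ∀ x ∈ Ioc a b, 0 < zT x ∧ 0 < yz x := by
  obtain ⟨δ, hδ, hpos⟩ := h.exists_pos_near hqc hr
  have hzT : ∀ x ∈ Ioc a b, 0 < zT x := by
    intro x hx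
    refine pos_of_ne_zero_of_pos_left hx.1.le (h.cont_zT.mono Icc_subset_Ici_self)
      (by rw [h.zT_left]; exact one_pos) fun t ht => ?_
    rcases ht.1.eq_or_lt with rfl | hat
    · rw [h.zT_left]; exact one_ne_zero
    · exact hne t ⟨hat, ht.2.trans hx.2⟩
  refine fun x hx => ⟨hzT x hx, ?_⟩
  obtain ⟨s, hs1, hs2⟩ := exists_between (lt_min hx.1 (lt_add_of_pos_right a hδ))
  have hsx : s ≤ x := hs2.le.trans (min_le_left _ _)
  have hspos := (hpos s ⟨hs1, hs2.trans_le (min_le_right _ _)⟩).2.1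
  have hsub : Icc s x ⊆ Ici a := fun t ht => hs1.le.trans ht.1
  refine pos_of_ne_zero_of_pos_left hsx (h.cont_yz.mono hsub) hspos ?_
  by_contra! hex
  obtain ⟨t₀, ht₀, ht₀'⟩ := hex
  have hcomp : IsCompact (Icc s x ∩ yz ⁻¹' {0}) :=
    isCompact_Icc.of_isClosed_subset
      ((h.cont_yz.mono hsub).preimage_isClosed_of_isClosed isClosed_Icc isClosed_singleton)
      inter_subset_left
  obtain ⟨c, ⟨hcI, hc0⟩, hcmin⟩ := hcomp.exists_isLeast ⟨t₀, ht₀, ht₀'⟩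
  replace hc0 : yz c = 0 := hc0
  have hsc : s < c := hcI.1.lt_of_ne (by rintro rfl; exact hspos.ne' hc0)
  have hca : c ∈ Ici a := hsub hcI
  have hleft : ∀ t ∈ Ico s c, 0 < yz t := fun t ht =>
    pos_of_ne_zero_of_pos_left ht.1 (h.cont_yz.mono fun t' ht' => hs1.le.trans ht'.1) hspos
      fun t' ht' h0 => (ht'.2.trans_lt ht.2).not_ge
        (hcmin ⟨⟨ht'.1, ht'.2.trans (ht.2.le.trans hcI.2)⟩, h0⟩)
  have hzTc := hzT c ⟨hs1.trans hsc, hcI.2.trans hx.2⟩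
  have hpl := h.plucker c hca
  rw [hc0, zero_mul, zero_add] at hpl
  have hymc : 0 ≤ ym c := by
    by_contra! hneg
    nlinarith [sq_nonneg (yT c), mul_neg_of_neg_of_pos hneg hzTc]
  have hymc' : ym c ≤ 0 := by
    by_contra! hp
    have hev := (h.cont_ym c hca).eventually (lt_mem_nhds hp)
    rw [eventually_nhdsWithin_iff, Metric.eventually_nhds_iff] at hev
    obtain ⟨ε, hε, hev⟩ := hev
    obtain ⟨t, ht1, ht2⟩ := exists_between (max_lt hsc (sub_lt_self c hε))
    have hst := (le_max_left _ _).trans_lt ht1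
    have hεt := (le_max_right _ _).trans_lt ht1
    have := lt_of_hasDerivWithinAt_pos (f := yz) (hs1.le.trans hst.le) ht2
      (fun t' ht' => h.d_yz t' (hs1.le.trans (hst.le.trans ht'.1))) fun t' ht' =>
      div_pos (hev (by rw [Real.dist_eq, abs_lt]; constructor <;> linarith [ht'.1, ht'.2])
        (hs1.le.trans (hst.le.trans ht'.1.le))) (hr _ (hs1.le.trans (hst.le.trans ht'.1.le)))
    linarith [hleft t ⟨hst.le, ht2⟩]
  have hym0 : ym c = 0 := le_antisymm hymc' hymc
  have hyT0 : yT c = 0 := by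
    rw [hym0, zero_mul] at hpl
    exact pow_eq_zero_iff two_ne_zero |>.1 hpl.symm
  obtain ⟨ε, hε, hsign⟩ := h.exists_sign_deriv_ym hqc hca hc0 hym0 hyT0 hzTc
  obtain ⟨t, ht1, ht2⟩ := exists_between (max_lt hsc (sub_lt_self c hε))
  have hst := (le_max_left _ _).trans_lt ht1
  have hεt := (le_max_right _ _).trans_lt ht1
  have hmem : ∀ t' ∈ Icc t c, t' ∈ Ici a := fun t' ht' => hs1.le.trans (hst.le.trans ht'.1)
  have hymleft : ∀ t' ∈ Ico t c, 0 < ym t' := by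
    intro t' ht'
    have := lt_of_hasDerivWithinAt_pos (f := fun x => -ym x) (hmem t' ⟨ht'.1, ht'.2.le⟩) ht'.2
      (fun w hw => (h.d_ym w (hmem w ⟨ht'.1.trans hw.1, hw.2⟩)).neg) fun w hw => by
        have hw' : t < w := ht'.1.trans_lt hw.1
        have := hsign w (hmem w ⟨hw'.le, hw.2.le⟩) hw.2.ne
          (by rw [abs_lt]; constructor <;> linarith [hw.2])
        nlinarith [hw.2]
    simpa [hym0] using this
  have := lt_of_hasDerivWithinAt_pos (f := yz) (hmem t ⟨le_rfl, ht2.le⟩) ht2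
    (fun w hw => h.d_yz w (hmem w hw)) fun w hw =>
      div_pos (hymleft w ⟨hw.1.le, hw.2⟩) (hr w (hmem w ⟨hw.1.le, hw.2.le⟩))
  linarith [hleft t ⟨hst.le, ht2⟩]

end IsMinorSystem

/-! ### Nonnegative energy on short intervals. -/

/-- The energy `∫ r f''² + q f'² - p f²` is nonnegative on short intervals `[a, x]` for functions
with `f(a) = f(x) = f'(x) = 0`. It enters through a lower bound for the derivative of `g`. -/
lemma exists_energy_nonneg {r q p : ℝ → ℝ} {a : ℝ} (hrc : ContinuousOn r (Ici a))
    (hqc : ContinuousOn q (Ici a)) (hpc : ContinuousOn p (Ici a)) (hr : ∀ x ∈ Ici a, 0 < r x) :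
    ∃ δ > 0, ∀ x ∈ Ioc a (a + δ), ∀ f f' f'' g g' : ℝ → ℝ,
      (∀ t ∈ Icc a x, HasDerivWithinAt f (f' t) (Ici a) t) →
      (∀ t ∈ Icc a x, HasDerivWithinAt f' (f'' t) (Ici a) t) →
      (∀ t ∈ Icc a x, HasDerivWithinAt g (g' t) (Ici a) t) →
      (∀ t ∈ Icc a x, r t * f'' t ^ 2 + q t * f' t ^ 2 - p t * f t ^ 2 ≤ g' t) →
      f a = 0 → f x = 0 → f' x = 0 → g a ≤ g x := by
  have hsub : Icc a (a + 1) ⊆ Ici a := Icc_subset_Ici_self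
  obtain ⟨x₀, hx₀, hmin⟩ := isCompact_Icc.exists_isMinOn
    (nonempty_Icc.2 (le_add_of_nonneg_right zero_le_one)) (hrc.mono hsub)
  have hm : 0 < r x₀ := hr x₀ (hsub hx₀)
  replace hmin : ∀ t ∈ Icc a (a + 1), r x₀ ≤ r t := fun t ht => hmin ht
  set m := r x₀ with hmdef
  obtain ⟨C, hC⟩ := isCompact_Icc.bddAbove_image ((hqc.abs.add hpc.abs).mono hsub)
  replace hC : ∀ t ∈ Icc a (a + 1), |q t| + |p t| ≤ C := fun t ht => hC (mem_image_of_mem _ ht)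
  have hC0 : 0 ≤ C := by
    have := hC x₀ hx₀
    linarith [abs_nonneg (q x₀), abs_nonneg (p x₀)]
  -- The last two bounds are what the two completed squares `j2` and `j1` need.
  obtain ⟨δ, hδ, hδ1, hδ2, hδ3⟩ : ∃ δ : ℝ, 0 < δ ∧ δ ≤ 1 ∧ δ * (C + 1) ≤ 1 ∧
      (C + 2) ^ 2 * δ ≤ m := by
    refine ⟨min (1 / (C + 1)) (m / (C + 2) ^ 2), by positivity, ?_, ?_, ?_⟩
    · exact (min_le_left _ _).trans (by rw [div_le_one (by positivity)]; linarith)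
    · rw [← le_div_iff₀ (by positivity)]; exact min_le_left _ _
    · rw [mul_comm, ← le_div_iff₀ (by positivity)]; exact min_le_right _ _
  refine ⟨δ, hδ, fun x hx f f' f'' g g' hf hf' hg hge hfa hfx hfx' => ?_⟩
  -- The added terms vanish at both ends. Their derivatives supply `(C + 2) f'²` and `(C + 1) f²`:
  -- the multiples `C` absorb `q` and `p`, and the surplus `2 f'² + f²` together with `m f''²`
  -- absorbs the cross terms.
  have key := le_of_hasDerivWithinAt_nonneg (a := a) (s := a) (t := x)
    (f := fun t => g t + (C + 2) * (t - a) * f' t ^ 2 - (C + 1) * (x - t) * f t ^ 2)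
    (f' := fun t => g' t + ((C + 2) * f' t ^ 2 + (C + 2) * (t - a) * (2 * f' t * f'' t)) -
      (-(C + 1) * f t ^ 2 + (C + 1) * (x - t) * (2 * f t * f' t))) le_rfl hx.1.le ?_ ?_
  · simpa [hfa, hfx, hfx'] using key
  · intro t ht
    have e1 : HasDerivWithinAt (fun t => (C + 2) * (t - a)) ((C + 2) * 1) (Ici a) t :=
      ((hasDerivWithinAt_id t _).sub_const a).const_mul _
    have e2 : HasDerivWithinAt (fun t => (C + 1) * (x - t)) ((C + 1) * (-1)) (Ici a) t :=
      ((hasDerivWithinAt_id t _).const_sub x).const_mul _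
    have e3 := (hf' t ht).pow 2
    have e4 := (hf t ht).pow 2
    refine (((hg t ht).add (e1.mul e3)).sub (e2.mul e4)).congr_deriv ?_
    simp only [Pi.pow_apply]
    push_cast
    ring
  · intro t ht
    have ht1 : t ∈ Icc a (a + 1) := ⟨ht.1.le, by linarith [ht.2, hx.2]⟩
    have hge' := hge t ⟨ht.1.le, ht.2.le⟩
    have hCt := hC t ht1
    have hq := neg_abs_le (q t)
    have hp := le_abs_self (p t)
    have hq0 := abs_nonneg (q t)
    have hp0 := abs_nonneg (p t)
    have i1 : -C * f' t ^ 2 ≤ q t * f' t ^ 2 :=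
      mul_le_mul_of_nonneg_right (by linarith) (sq_nonneg _)
    have i2 : p t * f t ^ 2 ≤ C * f t ^ 2 :=
      mul_le_mul_of_nonneg_right (by linarith) (sq_nonneg _)
    have i3 : m * f'' t ^ 2 ≤ r t * f'' t ^ 2 :=
      mul_le_mul_of_nonneg_right (hmin t ht1) (sq_nonneg _)
    set τ := t - a with hτ
    set σ := x - t with hσ
    have hτ0 : 0 ≤ τ := by linarith [ht.1]
    have hτδ : τ ≤ δ := by linarith [ht.2, hx.2]
    have hσ0 : 0 ≤ σ := by linarith [ht.2]
    have hσδ : σ ≤ δ := by linarith [ht.1, hx.2]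
    have j1 : 0 ≤ m * f'' t ^ 2 + (C + 2) * τ * (2 * f' t * f'' t) + f' t ^ 2 := by
      have hle : ((C + 2) * τ) ^ 2 ≤ m := by
        calc ((C + 2) * τ) ^ 2 = (C + 2) ^ 2 * (τ * τ) := by ring
          _ ≤ (C + 2) ^ 2 * (δ * 1) := by gcongr; linarith
          _ ≤ m := by linarith
      nlinarith [sq_nonneg ((C + 2) * τ * f'' t + f' t),
        mul_le_mul_of_nonneg_right hle (sq_nonneg (f'' t))]
    have j2 : 0 ≤ f' t ^ 2 - (C + 1) * σ * (2 * f t * f' t) + f t ^ 2 := by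
      have hle : (C + 1) * σ ≤ 1 := by nlinarith
      have hle' : ((C + 1) * σ) ^ 2 ≤ 1 := pow_le_one₀ (by positivity) hle
      nlinarith [sq_nonneg ((C + 1) * σ * f t - f' t),
        mul_le_mul_of_nonneg_right hle' (sq_nonneg (f t))]
    nlinarith

/-! ### The conjoined pair and its minors. -/

/-- `u` and `v` solve the system with initial values `(0, 1, 0, 0)` and
`(0, 0, 0, 1)`. -/
structure IsConjoinedPair (r q p : ℝ → ℝ) (a : ℝ) (u uz um uT v vz vm vT : ℝ → ℝ) : Prop where
  left : IsQuasiSolution r q p a u uz um uT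
  right : IsQuasiSolution r q p a v vz vm vT
  u_a : u a = 0
  uz_a : uz a = 1
  um_a : um a = 0
  uT_a : uT a = 0
  v_a : v a = 0
  vz_a : vz a = 0
  vm_a : vm a = 0
  vT_a : vT a = 1

variable {r q p : ℝ → ℝ} {a : ℝ} {u uz um uT v vz vm vT : ℝ → ℝ}

namespace IsConjoinedPair

/-- The Lagrange bracket of two solutions is constant, and it vanishes at `a` by the initial values.
Thus the minors `(y, T)` and `(z, m)` coincide, which produces the factor 2 in `d_ym` and the square
in `plucker`. -/
lemma lagrange (h : IsConjoinedPair r q p a u uz um uT v vz vm vT) {x : ℝ} (hx : x ∈ Ici a) :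
    u x * vT x - v x * uT x = uz x * vm x - vz x * um x := by
  have hd : ∀ t ∈ Ici a, HasDerivWithinAt
      (fun t => u t * vT t - v t * uT t - (uz t * vm t - vz t * um t)) 0 (Ici a) t := fun t ht =>
    ((((h.left.dy t ht).mul (h.right.dT t ht)).sub ((h.right.dy t ht).mul (h.left.dT t ht))).sub
      (((h.left.dz t ht).mul (h.right.dm t ht)).sub
        ((h.right.dz t ht).mul (h.left.dm t ht)))).congr_deriv (by ring)
  have h1 := le_of_hasDerivWithinAt_nonneg (f' := fun _ => 0) le_rfl hx
    (fun t ht => hd t ht.1) fun _ _ => le_rfl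
  have h2 := le_of_hasDerivWithinAt_nonneg (f' := fun _ => 0) le_rfl hx
    (fun t ht => (hd t ht.1).neg.congr_deriv neg_zero) fun _ _ => le_rfl
  simp only [h.u_a, h.uz_a, h.um_a, h.uT_a, h.v_a, h.vz_a, h.vm_a, h.vT_a, Pi.neg_apply] at h1 h2
  linarith

lemma isMinorSystem (h : IsConjoinedPair r q p a u uz um uT v vz vm vT) :
    IsMinorSystem r q p a (fun x => u x * vz x - v x * uz x) (fun x => u x * vm x - v x * um x)
      (fun x => u x * vT x - v x * uT x) (fun x => uz x * vT x - vz x * uT x)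
      (fun x => um x * vT x - vm x * uT x) where
  d_yz x hx := (((h.left.dy x hx).mul (h.right.dz x hx)).sub
    ((h.right.dy x hx).mul (h.left.dz x hx))).congr_deriv (by ring)
  d_ym x hx := (((h.left.dy x hx).mul (h.right.dm x hx)).sub
    ((h.right.dy x hx).mul (h.left.dm x hx))).congr_deriv (by linear_combination -h.lagrange hx)
  d_yT x hx := (((h.left.dy x hx).mul (h.right.dT x hx)).sub
    ((h.right.dy x hx).mul (h.left.dT x hx))).congr_deriv (by ring)
  d_zT x hx := (((h.left.dz x hx).mul (h.right.dT x hx)).sub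
    ((h.right.dz x hx).mul (h.left.dT x hx))).congr_deriv (by ring)
  plucker x hx := by linear_combination (-(u x * vT x - v x * uT x)) * h.lagrange hx
  yz_left := by simp [h.u_a, h.v_a]
  ym_left := by simp [h.u_a, h.v_a]
  yT_left := by simp [h.u_a, h.v_a]
  zT_left := by simp [h.uz_a, h.vT_a, h.vz_a]

end IsConjoinedPair

/-! ### Picone's inequality and its equality case. -/

variable {r₀ q₀ p₀ : ℝ → ℝ} {b : ℝ} {y z m T : ℝ → ℝ}

/-- The Riccati equation of the pair, written as the derivative of its quadratic form along `(y,
z)`. For a conjoined pair, `(ym z - yT y) / yz` is the value of `w₁` for the combination `w` that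
matches `y` and `y'` at the point. -/
lemma IsMinorSystem.hasDerivWithinAt_form {yz ym yT zT mT : ℝ → ℝ}
    (h : IsMinorSystem r q p a yz ym yT zT mT) (hy : IsQuasiSolution r₀ q₀ p₀ a y z m T)
    {x : ℝ} (hx : x ∈ Ici a) (hrx : r x ≠ 0) (hne : yz x ≠ 0) :
    HasDerivWithinAt
      (fun t => (zT t * y t ^ 2 - 2 * yT t * (y t * z t) + ym t * z t ^ 2) / yz t)
      (q x * z x ^ 2 - p x * y x ^ 2 +
        2 * (m x / r₀ x) * ((ym x * z x - yT x * y x) / yz x) -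
        ((ym x * z x - yT x * y x) / yz x) ^ 2 / r x) (Ici a) x := by
  have e1 := (h.d_zT x hx).mul ((hy.dy x hx).pow 2)
  have e2 := ((h.d_yT x hx).const_mul 2).mul ((hy.dy x hx).mul (hy.dz x hx))
  have e3 := (h.d_ym x hx).mul ((hy.dz x hx).pow 2)
  refine (((e1.sub e2).add e3).div (h.d_yz x hx) hne).congr_deriv ?_
  simp only [Pi.mul_apply, Pi.add_apply, Pi.sub_apply, Pi.pow_apply]
  generalize m x / r₀ x = s
  have hpl := h.plucker x hx
  push_cast
  field_simp
  linear_combination (-y x ^ 2) * hpl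

namespace IsConjoinedPair

/-- Let `w` be the combination of `u`, `v` with `w = y` and `w' = y'` at `x`; the form equals its
boundary term there. The energy of `y` minus that of `w` is at least the energy of `y - w`, up to a
cross term that integrates to zero, and `exists_energy_nonneg` applies to `y - w`. -/
lemma form_le_near (h : IsConjoinedPair r q p a u uz um uT v vz vm vT)
    (hy : IsQuasiSolution r₀ q₀ p₀ a y z m T)
    (hrc : ContinuousOn r (Ici a)) (hqc : ContinuousOn q (Ici a)) (hpc : ContinuousOn p (Ici a))
    (hr : ∀ x ∈ Ici a, 0 < r x)
    (hrr : ∀ x ∈ Ici a, r x ≤ r₀ x) (hpp : ∀ x ∈ Ici a, p₀ x ≤ p x)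
    (hqq : ∀ x ∈ Ici a, q x ≤ q₀ x) (hya : y a = 0) (hma : m a = 0) :
    ∃ δ > 0, ∀ x ∈ Ioc a (a + δ), u x * vz x - v x * uz x ≠ 0 →
      ((uz x * vT x - vz x * uT x) * y x ^ 2 - 2 * (u x * vT x - v x * uT x) * (y x * z x) +
        (u x * vm x - v x * um x) * z x ^ 2) / (u x * vz x - v x * uz x) ≤
      z x * m x - y x * T x := by
  obtain ⟨δ, hδ, H⟩ := exists_energy_nonneg hrc hqc hpc hr
  refine ⟨δ, hδ, fun x hx hne => ?_⟩
  obtain ⟨α, hα⟩ : ∃ α, α * (u x * vz x - v x * uz x) = y x * vz x - z x * v x :=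
    ⟨_, div_mul_cancel₀ _ hne⟩
  obtain ⟨β, hβ⟩ : ∃ β, β * (u x * vz x - v x * uz x) = u x * z x - uz x * y x :=
    ⟨_, div_mul_cancel₀ _ hne⟩
  have hw := h.left.comb h.right α β
  have hwa : α * u a + β * v a = 0 := by rw [h.u_a, h.v_a]; ring
  have hwma : α * um a + β * vm a = 0 := by rw [h.um_a, h.vm_a]; ring
  have hwx : α * u x + β * v x = y x :=
    mul_right_cancel₀ hne (by linear_combination u x * hα + v x * hβ)
  have hwzx : α * uz x + β * vz x = z x :=
    mul_right_cancel₀ hne (by linear_combination uz x * hα + vz x * hβ)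
  have hform : ((uz x * vT x - vz x * uT x) * y x ^ 2 -
      2 * (u x * vT x - v x * uT x) * (y x * z x) +
      (u x * vm x - v x * um x) * z x ^ 2) / (u x * vz x - v x * uz x) =
      z x * (α * um x + β * vm x) - y x * (α * uT x + β * vT x) := by
    rw [div_eq_iff hne]
    linear_combination (-z x * um x + y x * uT x) * hα + (-z x * vm x + y x * vT x) * hβ -
      y x * z x * h.lagrange hx.1.le
  rw [hform]
  obtain ⟨w, hwd⟩ : ∃ w, w = fun t => α * u t + β * v t := ⟨_, rfl⟩
  obtain ⟨wz, hwzd⟩ : ∃ w, w = fun t => α * uz t + β * vz t := ⟨_, rfl⟩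
  obtain ⟨wm, hwmd⟩ : ∃ w, w = fun t => α * um t + β * vm t := ⟨_, rfl⟩
  obtain ⟨wT, hwTd⟩ : ∃ w, w = fun t => α * uT t + β * vT t := ⟨_, rfl⟩
  rw [← hwd, ← hwzd, ← hwmd, ← hwTd] at hw
  replace hwa : w a = 0 := by rw [hwd]; exact hwa
  replace hwma : wm a = 0 := by rw [hwmd]; exact hwma
  replace hwx : w x = y x := by rw [hwd]; exact hwx
  replace hwzx : wz x = z x := by rw [hwzd]; exact hwzx
  rw [show α * um x + β * vm x = wm x by rw [hwmd], show α * uT x + β * vT x = wT x by rw [hwTd]]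
  have key := H x hx (fun t => y t - w t) (fun t => z t - wz t)
    (fun t => m t / r₀ t - wm t / r t)
    -- The last bracket is the integrated cross term. The whole expression vanishes at `a`, and at
    -- `x` it is the difference of the two sides of the claim.
    (fun t => z t * m t - y t * T t - (wz t * wm t - w t * wT t) -
      2 * ((z t - wz t) * wm t - (y t - w t) * wT t))
    (fun t => m t / r₀ t * m t + q₀ t * z t ^ 2 - p₀ t * y t ^ 2 -
      (wm t / r t * wm t + q t * wz t ^ 2 - p t * w t ^ 2) -
      2 * ((m t / r₀ t - wm t / r t) * wm t + (z t - wz t) * (q t * wz t) -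
        (y t - w t) * (p t * w t)))
    (fun t ht => (hy.dy t ht.1).sub (hw.dy t ht.1))
    (fun t ht => (hy.dz t ht.1).sub (hw.dz t ht.1)) (fun t ht => ?_) (fun t ht => ?_)
    (by simp [hya, hwa]) (by simp [hwx]) (by simp [hwzx])
  · simp only [hya, hma, hwa, hwma, hwx, hwzx] at key
    linarith
  · have y0 := hy.dy t ht.1
    have y1 := hy.dz t ht.1
    have w0 := hw.dy t ht.1
    have w1 := hw.dz t ht.1
    have w2 := hw.dm t ht.1
    have w3 := hw.dT t ht.1
    exact ((((y1.mul (hy.dm t ht.1)).sub (y0.mul (hy.dT t ht.1))).sub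
      ((w1.mul w2).sub (w0.mul w3))).sub
      ((((y1.sub w1).mul w2).sub ((y0.sub w0).mul w3)).const_mul 2)).congr_deriv
      (by simp only [Pi.sub_apply]; ring)
  · have ht0 : t ∈ Ici a := ht.1
    have hrt := hr t ht0
    have hr₀t : 0 < r₀ t := hrt.trans_le (hrr t ht0)
    obtain ⟨s, hs⟩ : ∃ s, s = m t / r₀ t := ⟨_, rfl⟩
    obtain ⟨σ, hσ⟩ : ∃ s, s = wm t / r t := ⟨_, rfl⟩
    have hms : m t = r₀ t * s := by rw [hs, mul_div_cancel₀ _ hr₀t.ne']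
    have hwms : wm t = r t * σ := by rw [hσ, mul_div_cancel₀ _ hrt.ne']
    simp only [← hs, ← hσ]
    rw [hms, hwms]
    nlinarith [mul_le_mul_of_nonneg_right (hrr t ht0) (sq_nonneg s),
      mul_le_mul_of_nonneg_right (hqq t ht0) (sq_nonneg (z t)),
      mul_le_mul_of_nonneg_right (hpp t ht0) (sq_nonneg (y t))]

/-- Picone's inequality: the quadratic form of a conjoined pair is dominated by the energy of a
solution of the comparison equation, and the difference is nondecreasing. -/
lemma picone (h : IsConjoinedPair r q p a u uz um uT v vz vm vT)
    (hy : IsQuasiSolution r₀ q₀ p₀ a y z m T)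
    (hrc : ContinuousOn r (Ici a)) (hqc : ContinuousOn q (Ici a)) (hpc : ContinuousOn p (Ici a))
    (hr : ∀ x ∈ Ici a, 0 < r x)
    (hrr : ∀ x ∈ Ici a, r x ≤ r₀ x) (hpp : ∀ x ∈ Ici a, p₀ x ≤ p x)
    (hqq : ∀ x ∈ Ici a, q x ≤ q₀ x) (hya : y a = 0) (hma : m a = 0)
    (hpos : ∀ x ∈ Ioc a b, 0 < u x * vz x - v x * uz x) :
    ∃ φ φ' : ℝ → ℝ, (∀ x, φ x = z x * m x - y x * T x -
      ((uz x * vT x - vz x * uT x) * y x ^ 2 - 2 * (u x * vT x - v x * uT x) * (y x * z x) +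
        (u x * vm x - v x * um x) * z x ^ 2) / (u x * vz x - v x * uz x)) ∧
      (∀ x ∈ Ioc a b, 0 ≤ φ x) ∧ MonotoneOn φ (Ioc a b) ∧
      (∀ x ∈ Ioc a b, HasDerivWithinAt φ (φ' x) (Ici a) x) ∧
      ∀ x ∈ Ioc a b, (r x * (m x / r₀ x) - ((u x * vm x - v x * um x) * z x -
        (u x * vT x - v x * uT x) * y x) / (u x * vz x - v x * uz x)) ^ 2 / r x ≤ φ' x := by
  have hM := h.isMinorSystem
  have hd : ∀ x ∈ Ioc a b, HasDerivWithinAt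
      (fun x => z x * m x - y x * T x -
      ((uz x * vT x - vz x * uT x) * y x ^ 2 - 2 * (u x * vT x - v x * uT x) * (y x * z x) +
        (u x * vm x - v x * um x) * z x ^ 2) / (u x * vz x - v x * uz x))
      (m x / r₀ x * m x + q₀ x * z x ^ 2 - p₀ x * y x ^ 2 -
        (q x * z x ^ 2 - p x * y x ^ 2 + 2 * (m x / r₀ x) *
          (((u x * vm x - v x * um x) * z x - (u x * vT x - v x * uT x) * y x) /
            (u x * vz x - v x * uz x)) -
        (((u x * vm x - v x * um x) * z x - (u x * vT x - v x * uT x) * y x) /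
            (u x * vz x - v x * uz x)) ^ 2 / r x)) (Ici a) x := fun x hx => by
    have hxa : x ∈ Ici a := hx.1.le
    exact ((((hy.dz x hxa).mul (hy.dm x hxa)).sub ((hy.dy x hxa).mul (hy.dT x hxa))).congr_deriv
      (by ring)).sub (hM.hasDerivWithinAt_form hy hxa (hr x hxa).ne' (hpos x hx).ne')
  have hd' : ∀ x ∈ Ioc a b, (r x * (m x / r₀ x) - ((u x * vm x - v x * um x) * z x -
        (u x * vT x - v x * uT x) * y x) / (u x * vz x - v x * uz x)) ^ 2 / r x ≤
      m x / r₀ x * m x + q₀ x * z x ^ 2 - p₀ x * y x ^ 2 -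
        (q x * z x ^ 2 - p x * y x ^ 2 + 2 * (m x / r₀ x) *
          (((u x * vm x - v x * um x) * z x - (u x * vT x - v x * uT x) * y x) /
            (u x * vz x - v x * uz x)) -
        (((u x * vm x - v x * um x) * z x - (u x * vT x - v x * uT x) * y x) /
            (u x * vz x - v x * uz x)) ^ 2 / r x) := fun x hx => by
    have hxa : x ∈ Ici a := hx.1.le
    have hrx := hr x hxa
    have hr₀x : 0 < r₀ x := hrx.trans_le (hrr x hxa)
    generalize ((u x * vm x - v x * um x) * z x - (u x * vT x - v x * uT x) * y x) /
            (u x * vz x - v x * uz x) = w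
    obtain ⟨s, hs⟩ : ∃ s, s = m x / r₀ x := ⟨_, rfl⟩
    have hms : m x = r₀ x * s := by rw [hs, mul_div_cancel₀ _ hr₀x.ne']
    rw [← hs, hms]
    -- Replacing `r₀ s²` by the smaller `r s²` completes the square.
    have : (r x * s - w) ^ 2 / r x = r x * s ^ 2 - 2 * s * w + w ^ 2 / r x := by
      field_simp; ring
    rw [this]
    nlinarith [mul_le_mul_of_nonneg_right (hrr x hxa) (sq_nonneg s),
      mul_le_mul_of_nonneg_right (hqq x hxa) (sq_nonneg (z x)),
      mul_le_mul_of_nonneg_right (hpp x hxa) (sq_nonneg (y x))]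
  have hmono : MonotoneOn (fun x => z x * m x - y x * T x -
      ((uz x * vT x - vz x * uT x) * y x ^ 2 - 2 * (u x * vT x - v x * uT x) * (y x * z x) +
        (u x * vm x - v x * um x) * z x ^ 2) / (u x * vz x - v x * uz x)) (Ioc a b) := by
    intro s hs t ht hst
    refine le_of_hasDerivWithinAt_nonneg hs.1.le hst
      (fun x hx => hd x ⟨hs.1.trans_le hx.1, hx.2.trans ht.2⟩) fun x hx => ?_
    have hx' : x ∈ Ioc a b := ⟨hs.1.trans hx.1, hx.2.le.trans ht.2⟩
    exact (div_nonneg (sq_nonneg _) (hr x hx'.1.le).le).trans (hd' x hx')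
  refine ⟨_, _, fun x => rfl, fun x hx => ?_, hmono, hd, hd'⟩
  -- The denominator vanishes at `a`, so nonnegativity is taken at some `s` near `a` and carried to
  -- `x` by monotonicity.
  obtain ⟨δ, hδ, H⟩ := h.form_le_near hy hrc hqc hpc hr hrr hpp hqq hya hma
  obtain ⟨s, hs1, hs2⟩ := exists_between (lt_min hx.1 (lt_add_of_pos_right a hδ))
  have hsx := hs2.trans_le (min_le_left _ _)
  have hs : s ∈ Ioc a b := ⟨hs1, hsx.le.trans hx.2⟩
  exact (sub_nonneg.2 (H s ⟨hs1, hs2.le.trans (min_le_right _ _)⟩ (hpos s hs).ne')).trans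
    (hmono hs hx hsx.le)

/-- If the comparison solution vanishes to first order at `b`, then equality holds in Picone's
inequality, and the comparison solution vanishes. -/
lemma eq_zero_of_picone_eq (h : IsConjoinedPair r q p a u uz um uT v vz vm vT)
    (hy : IsQuasiSolution r₀ q₀ p₀ a y z m T)
    (hrc : ContinuousOn r (Ici a)) (hqc : ContinuousOn q (Ici a)) (hpc : ContinuousOn p (Ici a))
    (hr : ∀ x ∈ Ici a, 0 < r x)
    (hrr : ∀ x ∈ Ici a, r x ≤ r₀ x) (hpp : ∀ x ∈ Ici a, p₀ x ≤ p x)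
    (hqq : ∀ x ∈ Ici a, q x ≤ q₀ x) (hya : y a = 0) (hma : m a = 0)
    (hpos : ∀ x ∈ Ioc a b, 0 < u x * vz x - v x * uz x) (hyb : y b = 0) (hzb : z b = 0) :
    ∀ x ∈ Ioc a b, y x = 0 := by
  intro x hx
  obtain ⟨φ, φ', hφ, hφ0, hmono, hd, hd'⟩ :=
    h.picone hy hrc hqc hpc hr hrr hpp hqq hya hma hpos
  have hb : b ∈ Ioc a b := ⟨hx.1.trans_le hx.2, le_rfl⟩
  have hφb : φ b = 0 := by rw [hφ, hyb, hzb]; simp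
  have hzero : ∀ t ∈ Ioc a b, φ t = 0 := fun t ht =>
    le_antisymm ((hmono ht hb ht.2).trans hφb.le) (hφ0 t ht)
  -- `φ` vanishes identically, hence so does the square in its derivative: with `y'' = m / r₀`, `y`
  -- solves the second order equation `r yz y'' = ym y' - yT y`.
  have hs : ∀ t ∈ Ioo a b, r t * (m t / r₀ t) * (u t * vz t - v t * uz t) =
      (u t * vm t - v t * um t) * z t - (u t * vT t - v t * uT t) * y t := by
    intro t ht
    have ht' : t ∈ Ioc a b := ⟨ht.1, ht.2.le⟩
    have h1 : HasDerivAt φ (φ' t) t := (hd t ht').hasDerivAt (Ici_mem_nhds ht.1)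
    have h2 : HasDerivAt φ 0 t := (hasDerivAt_const t (0 : ℝ)).congr_of_eventuallyEq
      (Filter.eventually_of_mem (Ioo_mem_nhds ht.1 ht.2)
        fun w hw => hzero w ⟨hw.1, hw.2.le⟩)
    have h3 := hd' t ht'
    have hrt := hr t ht.1.le
    rw [h1.unique h2, div_le_iff₀ hrt, zero_mul] at h3
    have h4 := pow_eq_zero_iff two_ne_zero |>.1 (le_antisymm h3 (sq_nonneg _))
    rw [← eq_div_iff (hpos t ht').ne']
    exact sub_eq_zero.1 h4
  have hM := h.isMinorSystem
  -- The identity assumed of `w` is the same second order equation. By Abel's formula the Wronskian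
  -- of `y` and `w` is a constant multiple of `yz`, and it vanishes at `b`. Taking `w = u` and `w =
  -- v` gives `y = 0`, since `u` and `v` are independent.
  have hconst : ∀ {w wz wm wT : ℝ → ℝ}, IsQuasiSolution r q p a w wz wm wT →
      (∀ t ∈ Ioo a b, (u t * vz t - v t * uz t) * wm t + (u t * vT t - v t * uT t) * w t -
        (u t * vm t - v t * um t) * wz t = 0) → y x * wz x - z x * w x = 0 := by
    intro w wz wm wT hw hid
    have hda : ∀ t ∈ Icc x b, HasDerivWithinAt
        (fun t => (y t * wz t - z t * w t) / (u t * vz t - v t * uz t))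
        (((y t * (wm t / r t) - m t / r₀ t * w t) * (u t * vz t - v t * uz t) -
          (y t * wz t - z t * w t) * ((u t * vm t - v t * um t) / r t)) /
          (u t * vz t - v t * uz t) ^ 2) (Ici a) t := fun t ht => by
      have hta : t ∈ Ici a := hx.1.le.trans ht.1
      exact ((((hy.dy t hta).mul (hw.dz t hta)).sub ((hy.dz t hta).mul (hw.dy t hta))).congr_deriv
        (by ring)).div (hM.d_yz t hta) (hpos t ⟨hx.1.trans_le ht.1, ht.2⟩).ne'
    have hda0 : ∀ t ∈ Ioo x b,
        ((y t * (wm t / r t) - m t / r₀ t * w t) * (u t * vz t - v t * uz t) -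
          (y t * wz t - z t * w t) * ((u t * vm t - v t * um t) / r t)) /
          (u t * vz t - v t * uz t) ^ 2 = 0 := fun t ht => by
      have ht' : t ∈ Ioo a b := ⟨hx.1.trans ht.1, ht.2⟩
      have hrt := (hr t ht'.1.le).ne'
      rw [div_eq_zero_iff]
      left
      refine mul_left_cancel₀ hrt ?_
      have e1 : r t * (wm t / r t) = wm t := mul_div_cancel₀ _ hrt
      have e2 : r t * ((u t * vm t - v t * um t) / r t) = u t * vm t - v t * um t :=
        mul_div_cancel₀ _ hrt
      linear_combination y t * (u t * vz t - v t * uz t) * e1 -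
        (y t * wz t - z t * w t) * e2 + y t * hid t ht' - w t * hs t ht'
    have h1 := le_of_hasDerivWithinAt_nonneg hx.1.le hx.2 hda fun t ht => (hda0 t ht).ge
    have h2 := le_of_hasDerivWithinAt_nonneg hx.1.le hx.2 (fun t ht => (hda t ht).neg)
      fun t ht => by rw [hda0 t ht, neg_zero]
    simp only [Pi.neg_apply, hyb, hzb, zero_mul, sub_zero, zero_div, neg_zero] at h1 h2
    have h3 : (y x * wz x - z x * w x) / (u x * vz x - v x * uz x) = 0 := by linarith
    exact (div_eq_zero_iff.1 h3).resolve_right (hpos x hx).ne'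
  have c1 := hconst h.left fun t ht => by linear_combination u t * h.lagrange ht.1.le
  have c2 := hconst h.right fun t ht => by linear_combination v t * h.lagrange ht.1.le
  have : y x * (u x * vz x - v x * uz x) = 0 := by linear_combination u x * c2 - v x * c1
  exact (mul_eq_zero.1 this).resolve_right (hpos x hx).ne'

end IsConjoinedPair

/-! ### Conjugate and focal points as zeros of minors. -/

theorem exists_isConjoinedPair
    (hrc : ContinuousOn r (Ici a)) (hqc : ContinuousOn q (Ici a)) (hpc : ContinuousOn p (Ici a))
    (hr : ∀ x ∈ Ici a, 0 < r x) :
    ∃ u uz um uT v vz vm vT : ℝ → ℝ, IsConjoinedPair r q p a u uz um uT v vz vm vT := by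
  obtain ⟨u, uz, um, uT, hu, h1, h2, h3, h4⟩ := exists_isQuasiSolution hrc hqc hpc hr 0 1 0 0
  obtain ⟨v, vz, vm, vT, hv, h5, h6, h7, h8⟩ := exists_isQuasiSolution hrc hqc hpc hr 0 0 0 1
  exact ⟨u, uz, um, uT, v, vz, vm, vT, hu, hv, h1, h2, h3, h4, h5, h6, h7, h8⟩

lemma eq_zero_of_hasDerivWithinAt_of_eq_zero {f f' : ℝ → ℝ} (hf : ∀ x ∈ Ico a b, f x = 0)
    (hd : ∀ x ∈ Ici a, HasDerivWithinAt f (f' x) (Ici a) x) : ∀ x ∈ Ico a b, f' x = 0 := by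
  intro x hx
  have h0 : HasDerivWithinAt f 0 (Ici a) x :=
    (hasDerivWithinAt_const x (Ici a) (0 : ℝ)).congr_of_eventuallyEq
      (by
        filter_upwards [self_mem_nhdsWithin, nhdsWithin_le_nhds (Iio_mem_nhds hx.2)] with t h1 h2
        exact hf t ⟨h1, h2⟩) (hf x hx)
  exact (uniqueDiffOn_Ici a x hx.1).eq_deriv _ (hd x hx.1) h0

/-- Successive differentiation of the system. It links nontriviality, stated through the values of
`y`, with the initial data at `a`. -/
lemma IsQuasiSolution.left_eq_zero (h : IsQuasiSolution r q p a y z m T)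
    (hr : ∀ x ∈ Ici a, 0 < r x) (hab : a < b) (hy : ∀ x ∈ Ico a b, y x = 0) :
    z a = 0 ∧ m a = 0 ∧ T a = 0 := by
  have hz := eq_zero_of_hasDerivWithinAt_of_eq_zero hy h.dy
  have hm := eq_zero_of_hasDerivWithinAt_of_eq_zero hz h.dz
  have hm' : ∀ x ∈ Ico a b, m x = 0 := fun x hx =>
    (div_eq_zero_iff.1 (hm x hx)).resolve_right (hr x hx.1).ne'
  have hT := eq_zero_of_hasDerivWithinAt_of_eq_zero hm' h.dm
  have ha : a ∈ Ico a b := left_mem_Ico.2 hab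
  refine ⟨hz a ha, hm' a ha, ?_⟩
  have := hT a ha
  rwa [hz a ha, mul_zero, add_zero] at this

lemma exists_ne_zero_of_det_eq_zero {A B C E : ℝ} (h : A * E - B * C = 0) :
    ∃ α β : ℝ, (α ≠ 0 ∨ β ≠ 0) ∧ α * A + β * B = 0 ∧ α * C + β * E = 0 := by
  by_cases hAB : A = 0 ∧ B = 0
  · by_cases hCE : C = 0 ∧ E = 0
    · exact ⟨1, 0, by simp, by simp [hAB.1], by simp [hCE.1]⟩
    · refine ⟨E, -C, ?_, by simp [hAB.1, hAB.2], by ring⟩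
      by_contra! h'
      exact hCE ⟨neg_eq_zero.1 h'.2, h'.1⟩
  · refine ⟨B, -A, ?_, by ring, by linear_combination -h⟩
    by_contra! h'
    exact hAB ⟨neg_eq_zero.1 h'.2, h'.1⟩

lemma det_eq_zero_of_ne_zero {A B C E α β : ℝ} (hne : α ≠ 0 ∨ β ≠ 0) (h1 : α * A + β * B = 0)
    (h2 : α * C + β * E = 0) : A * E - B * C = 0 := by
  rcases hne with h | h
  · exact mul_left_cancel₀ h (by linear_combination E * h1 - B * h2)
  · exact mul_left_cancel₀ h (by linear_combination A * h2 - C * h1)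

namespace IsConjoinedPair

lemma eq_comb (h : IsConjoinedPair r q p a u uz um uT v vz vm vT)
    (hy : IsQuasiSolution r q p a y z m T)
    (hrc : ContinuousOn r (Ici a)) (hqc : ContinuousOn q (Ici a)) (hpc : ContinuousOn p (Ici a))
    (hr : ∀ x ∈ Ici a, 0 < r x) (hya : y a = 0) (hma : m a = 0) {x : ℝ} (hx : x ∈ Ici a) :
    y x = z a * u x + T a * v x ∧ z x = z a * uz x + T a * vz x ∧
      m x = z a * um x + T a * vm x ∧ T x = z a * uT x + T a * vT x := by
  have hc := hy.comb (h.left.comb h.right (z a) (T a)) 1 (-1)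
  have := hc.eq_zero hrc hqc hpc hr (by simp [hya, h.u_a, h.v_a]) (by simp [h.uz_a, h.vz_a])
    (by simp [hma, h.um_a, h.vm_a]) (by simp [h.uT_a, h.vT_a]) hx
  refine ⟨?_, ?_, ?_, ?_⟩ <;> linarith [this.1, this.2.1, this.2.2.1, this.2.2.2]

lemma comb_nontrivial (h : IsConjoinedPair r q p a u uz um uT v vz vm vT)
    (hr : ∀ x ∈ Ici a, 0 < r x) {α β : ℝ} (hne : α ≠ 0 ∨ β ≠ 0) :
    IsNontrivialSolution r q p a (fun x => α * u x + β * v x) := by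
  have hc := h.left.comb h.right α β
  refine ⟨hc.isSolution hr, ?_⟩
  by_contra! h0
  obtain ⟨h1, -, h3⟩ := hc.left_eq_zero hr (lt_add_one a) fun x hx => h0 x hx.1
  simp only [h.uz_a, h.vz_a, h.uT_a, h.vT_a, mul_one, mul_zero, add_zero, zero_add] at h1 h3
  exact hne.elim (fun h' => h' h1) fun h' => h' h3

/-- By `eq_comb` every admissible solution is a combination of `u` and `v`, so the two conditions at
`c` form a homogeneous 2 × 2 system with this determinant. -/
lemma conjugate_iff (h : IsConjoinedPair r q p a u uz um uT v vz vm vT)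
    (hrc : ContinuousOn r (Ici a)) (hqc : ContinuousOn q (Ici a)) (hpc : ContinuousOn p (Ici a))
    (hr : ∀ x ∈ Ici a, 0 < r x) {c : ℝ} (hc : c ∈ Ici a) :
    (∃ y : ℝ → ℝ, IsNontrivialSolution r q p a y ∧
      y a = 0 ∧ quasiD₁ r a y a = 0 ∧ y c = 0 ∧ quasiD₁ r a y c = 0) ↔
    u c * vm c - v c * um c = 0 := by
  constructor
  · rintro ⟨y, ⟨hy, x, hx, hyx⟩, hya, hma, hyc, hmc⟩
    have e := fun {t : ℝ} (ht : t ∈ Ici a) =>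
      h.eq_comb (hy.isQuasiSolution hr) hrc hqc hpc hr hya hma ht
    refine det_eq_zero_of_ne_zero (α := D a y a) (β := quasiT r q a y a) ?_
      ((e hc).1.symm.trans hyc) ((e hc).2.2.1.symm.trans hmc)
    by_contra! h'
    exact hyx (by rw [(e hx).1, h'.1, h'.2]; ring)
  · intro h0
    obtain ⟨α, β, hne, h1, h2⟩ := exists_ne_zero_of_det_eq_zero h0
    have hs := h.left.comb h.right α β
    refine ⟨_, h.comb_nontrivial hr hne, by simp [h.u_a, h.v_a], ?_, h1, ?_⟩
    · rw [hs.quasiD₁_eq hr self_mem_Ici]; simp [h.um_a, h.vm_a]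
    · rw [hs.quasiD₁_eq hr hc]; exact h2

lemma focal_iff (h : IsConjoinedPair r q p a u uz um uT v vz vm vT)
    (hrc : ContinuousOn r (Ici a)) (hqc : ContinuousOn q (Ici a)) (hpc : ContinuousOn p (Ici a))
    (hr : ∀ x ∈ Ici a, 0 < r x) {c : ℝ} (hc : c ∈ Ici a) :
    (∃ y : ℝ → ℝ, IsNontrivialSolution r q p a y ∧
      y a = 0 ∧ quasiD₁ r a y a = 0 ∧ D a y c = 0 ∧ quasiT r q a y c = 0) ↔
    uz c * vT c - vz c * uT c = 0 := by
  constructor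
  · rintro ⟨y, ⟨hy, x, hx, hyx⟩, hya, hma, hzc, hTc⟩
    have e := fun {t : ℝ} (ht : t ∈ Ici a) =>
      h.eq_comb (hy.isQuasiSolution hr) hrc hqc hpc hr hya hma ht
    refine det_eq_zero_of_ne_zero (α := D a y a) (β := quasiT r q a y a) ?_
      ((e hc).2.1.symm.trans hzc) ((e hc).2.2.2.symm.trans hTc)
    by_contra! h'
    exact hyx (by rw [(e hx).1, h'.1, h'.2]; ring)
  · intro h0
    obtain ⟨α, β, hne, h1, h2⟩ := exists_ne_zero_of_det_eq_zero h0
    have hs := h.left.comb h.right α β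
    refine ⟨_, h.comb_nontrivial hr hne, by simp [h.u_a, h.v_a], ?_, ?_, ?_⟩
    · rw [hs.quasiD₁_eq hr self_mem_Ici]; simp [h.um_a, h.vm_a]
    · rw [hs.D_eq hc]; exact h1
    · rw [hs.quasiT_eq hr hc]; exact h2

/-- A solution of the comparison equation which satisfies the boundary conditions at `a`, vanishes
to first order at `b` and gives equality in Picone's inequality is trivial. -/
lemma not_nontrivial_of_eq_zero (h : IsConjoinedPair r q p a u uz um uT v vz vm vT)
    (hrc : ContinuousOn r (Ici a)) (hqc : ContinuousOn q (Ici a)) (hpc : ContinuousOn p (Ici a))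
    (hr₀c : ContinuousOn r₀ (Ici a)) (hq₀c : ContinuousOn q₀ (Ici a))
    (hp₀c : ContinuousOn p₀ (Ici a)) (hr : ∀ x ∈ Ici a, 0 < r x)
    (hrr : ∀ x ∈ Ici a, r x ≤ r₀ x) (hpp : ∀ x ∈ Ici a, p₀ x ≤ p x)
    (hqq : ∀ x ∈ Ici a, q x ≤ q₀ x) (hab : a < b)
    (hpos : ∀ x ∈ Ioc a b, 0 < u x * vz x - v x * uz x)
    (hy : IsNontrivialSolution r₀ q₀ p₀ a y) (hya : y a = 0) (hma : quasiD₁ r₀ a y a = 0)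
    (hyb : y b = 0) (hzb : D a y b = 0) : False := by
  obtain ⟨hy, x, hx, hyx⟩ := hy
  have hr₀ : ∀ x ∈ Ici a, 0 < r₀ x := fun x hx => (hr x hx).trans_le (hrr x hx)
  have hs := hy.isQuasiSolution hr₀
  have h0 := h.eq_zero_of_picone_eq hs hrc hqc hpc hr hrr hpp hqq hya hma hpos hyb hzb
  have h1 : ∀ t ∈ Ico a b, y t = 0 := by
    intro t ht
    rcases ht.1.eq_or_lt with rfl | hat
    · exact hya
    · exact h0 t ⟨hat, ht.2.le⟩
  obtain ⟨h2, h3, h4⟩ := hs.left_eq_zero hr₀ hab h1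
  exact hyx (hs.eq_zero hr₀c hq₀c hp₀c hr₀ hya h2 h3 h4 hx).1

end IsConjoinedPair

/-- The half-line `(a, ∞)` is not closed, so zeros might accumulate at `a`; the zero-free interval
`(a, a + δ)` restores compactness. -/
lemma exists_isLeast_zero {g : ℝ → ℝ} (hg : ContinuousOn g (Ici a)) {δ : ℝ} (hδ : 0 < δ)
    (hne : ∀ x ∈ Ioo a (a + δ), g x ≠ 0) (hex : ∃ x ∈ Ioc a b, g x = 0) :
    ∃ c, IsLeast {x | a < x ∧ g x = 0} c ∧ c ≤ b := by
  have hsub : Icc (a + δ) b ⊆ Ici a := fun x hx => (le_add_of_nonneg_right hδ.le).trans hx.1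
  have hcomp : IsCompact (Icc (a + δ) b ∩ g ⁻¹' {0}) :=
    isCompact_Icc.of_isClosed_subset
      ((hg.mono hsub).preimage_isClosed_of_isClosed isClosed_Icc isClosed_singleton)
      inter_subset_left
  have hge : ∀ x, a < x → g x = 0 → a + δ ≤ x := fun x hx h0 =>
    not_lt.1 fun hlt => hne x ⟨hx, hlt⟩ h0
  obtain ⟨x, hx, hgx⟩ := hex
  obtain ⟨c, ⟨hc, hgc⟩, hmin⟩ := hcomp.exists_isLeast ⟨x, ⟨hge x hx.1 hgx, hx.2⟩, hgx⟩
  refine ⟨c, ⟨⟨(lt_add_of_pos_right a hδ).trans_le hc.1, hgc⟩, fun t ht => ?_⟩, hc.2⟩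
  rcases le_total t b with htb | htb
  · exact hmin ⟨⟨hge t ht.1 ht.2, htb⟩, ht.2⟩
  · exact hc.2.trans htb

end FourthOrder

/-! ### The comparison theorem. -/

open FourthOrder in
theorem mainTheorem3 (a : ℝ) (ha : 0 ≤ a) (r q p r₀ q₀ p₀ : ℝ → ℝ)
    (hr : ContinuousOn r (Set.Ici a)) (hq : ContinuousOn q (Set.Ici a))
    (hp : ContinuousOn p (Set.Ici a))
    (hr₀ : ContinuousOn r₀ (Set.Ici a)) (hq₀ : ContinuousOn q₀ (Set.Ici a))
    (hp₀ : ContinuousOn p₀ (Set.Ici a))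
    (hr_pos : ∀ x ∈ Set.Ici a, 0 < r x) (hp_pos : ∀ x ∈ Set.Ici a, 0 < p x)
    (hr₀_pos : ∀ x ∈ Set.Ici a, 0 < r₀ x) (hp₀_pos : ∀ x ∈ Set.Ici a, 0 < p₀ x)
    (hrr : ∀ x ∈ Set.Ici a, r x ≤ r₀ x) (hpp : ∀ x ∈ Set.Ici a, p₀ x ≤ p x)
    (hqq : ∀ x ∈ Set.Ici a, q x ≤ q₀ x) :
    (∀ μ₀ : ℝ, FourthOrder.IsSystemsFocalPoint r₀ q₀ p₀ a μ₀ →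
      ∃ μ : ℝ, FourthOrder.IsSystemsFocalPoint r q p a μ ∧ a < μ ∧ μ ≤ μ₀) ∧
    (∀ η₀ : ℝ, FourthOrder.IsSystemsConjugatePoint r₀ q₀ p₀ a η₀ →
      ∃ η : ℝ, FourthOrder.IsSystemsConjugatePoint r q p a η ∧ a < η ∧ η ≤ η₀) := by

  obtain ⟨u, uz, um, uT, v, vz, vm, vT, h⟩ := exists_isConjoinedPair hr hq hp hr_pos
  have hM := h.isMinorSystem
  obtain ⟨δ, hδ, hnear⟩ := hM.exists_pos_near hq hr_pos
  refine ⟨fun b hb => ?_, fun b hb => ?_⟩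
  · obtain ⟨⟨hab, y, hy, hya, hma, hzb, hTb⟩, -⟩ := hb
    obtain ⟨c, hc, hcb⟩ := exists_isLeast_zero (b := b) hM.cont_zT hδ
      (fun x hx => (hnear x hx).2.2.ne') (by
        by_contra! hne
        have hpos := hM.pos_of_zT_ne_zero hq hr_pos hne
        have hb : b ∈ Ioc a b := ⟨hab, le_rfl⟩
        obtain ⟨φ, -, hφ, hφ0, -⟩ := h.picone (hy.1.isQuasiSolution hr₀_pos) hr hq hp hr_pos
          hrr hpp hqq hya hma fun x hx => (hpos x hx).2
        refine h.not_nontrivial_of_eq_zero hr hq hp hr₀ hq₀ hp₀ hr_pos hrr hpp hqq hab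
          (fun x hx => (hpos x hx).2) hy hya hma ?_ hzb
        -- Here `φ b = -zT y² / yz`, so nonnegativity forces `y b = 0`.
        have h1 := hφ0 b hb
        rw [hφ, hzb, hTb] at h1
        by_contra hyb
        have h2 : 0 < (uz b * vT b - vz b * uT b) * y b ^ 2 / (u b * vz b - v b * uz b) :=
          div_pos (mul_pos (hpos b hb).1 (by positivity)) (hpos b hb).2
        simp only [mul_zero, zero_mul, sub_zero, zero_sub, ne_eq, OfNat.ofNat_ne_zero,
          not_false_eq_true, zero_pow, add_zero] at h1
        linarith)
    have hset : {c : ℝ | a < c ∧ ∃ y : ℝ → ℝ, IsNontrivialSolution r q p a y ∧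
        y a = 0 ∧ quasiD₁ r a y a = 0 ∧ D a y c = 0 ∧ quasiT r q a y c = 0} =
        {c | a < c ∧ uz c * vT c - vz c * uT c = 0} :=
      ext fun c => and_congr_right fun hac => h.focal_iff hr hq hp hr_pos hac.le
    exact ⟨c, by rw [IsSystemsFocalPoint, hset]; exact hc, hc.1.1, hcb⟩
  · obtain ⟨⟨hab, y, hy, hya, hma, hyb, hmb⟩, -⟩ := hb
    obtain ⟨c, hc, hcb⟩ := exists_isLeast_zero (b := b) hM.cont_ym hδ
      (fun x hx => (hnear x hx).1.ne') (by
        by_contra! hne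
        have hpos := hM.pos_of_ym_ne_zero hq hr_pos hne
        have hb : b ∈ Ioc a b := ⟨hab, le_rfl⟩
        obtain ⟨φ, -, hφ, hφ0, -⟩ := h.picone (hy.1.isQuasiSolution hr₀_pos) hr hq hp hr_pos
          hrr hpp hqq hya hma fun x hx => (hpos x hx).2
        refine h.not_nontrivial_of_eq_zero hr hq hp hr₀ hq₀ hp₀ hr_pos hrr hpp hqq hab
          (fun x hx => (hpos x hx).2) hy hya hma hyb ?_
        -- Here `φ b = -ym y'² / yz`, so nonnegativity forces `y' b = 0`.
        have h1 := hφ0 b hb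
        rw [hφ, hyb, hmb] at h1
        by_contra hzb
        have h2 : 0 < (u b * vm b - v b * um b) * D a y b ^ 2 / (u b * vz b - v b * uz b) :=
          div_pos (mul_pos (hpos b hb).1 (by positivity)) (hpos b hb).2
        simp only [mul_zero, zero_mul, sub_zero, zero_sub, ne_eq, OfNat.ofNat_ne_zero,
          not_false_eq_true, zero_pow, zero_add] at h1
        linarith)
    have hset : {c : ℝ | a < c ∧ ∃ y : ℝ → ℝ, IsNontrivialSolution r q p a y ∧
        y a = 0 ∧ quasiD₁ r a y a = 0 ∧ y c = 0 ∧ quasiD₁ r a y c = 0} =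
        {c | a < c ∧ u c * vm c - v c * um c = 0} :=
      ext fun c => and_congr_right fun hac => h.conjugate_iff hr hq hp hr_pos hac.le
    exact ⟨c, by rw [IsSystemsConjugatePoint, hset]; exact hc, hc.1.1, hcb⟩
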